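/- Let $G,\Sigma\in\mathbb{R}^{n\times n}$ be symmetric positive definite, let $H\in\mathbb{R}^{n\times n}$ be symmetric, let $c\in\mathbb{R}$ and $\theta^*\in\mathbb{R}^n$, and let $$f(\theta)=c+\tfrac12(\theta-\theta^*)^\top H(\theta-\theta^*).$$ Let $\theta_0\in\mathbb{R}^n$ be a saddle point of $f$, that is, $\nabla f(\theta_0)=0$ and $H$ has a negative eigenvalue (a positive eigenvalue is not required). Let $(\boldsymbol n_t)_{t\ge0}$ be a standard Brownian motion in $\mathbb{R}^n$, and let $(\theta_t)_{t\ge 0}$ be a process with almost surely continuous paths that starts at the deterministic point $\theta_0$ and solves $$d\theta_t=-GH(\theta_t-\theta^*)\,dt+G\Sigma^{1/2}\,d\boldsymbol n_t ,$$ where $\Sigma^{1/2}$ is the positive semidefinite square root of $\Sigma$. Then $f(\theta_t)$ is integrable for every $t\ge0$, and the escape time $$t_{\mathrm{esc}}=\inf\{t\ge0:\ \mathbb{E}[f(\theta_t)]<f(\theta_0)\}$$ (with $\inf\emptyset=+\infty$) satisfies $$t_{\mathrm{esc}}\ \le\ \frac{\log\left(\operatorname{Tr}(\Sigma G)/\lambda_{\min}(\Sigma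 G)\right)}{|2\lambda_{\min}(GH)|},$$ where $\lambda_{\min}$ denotes the smallest eigenvalue (the matrices $\Sigma G$ and $GH$ are similar to symmetric matrices, so their spectra are real). -/

import Mathlib

open MeasureTheory ProbabilityTheory Matrix
open scoped NNReal MatrixOrder

namespace PrecondLangevin

/-- The smallest real eigenvalue of a square real matrix. For a product of a positive definite and
a symmetric matrix it is the smallest eigenvalue, see `isLeast_lambdaMin`. -/
noncomputable def lambdaMin {d : ℕ} (M : Matrix (Fin d) (Fin d) ℝ) : ℝ :=
  sInf (spectrum ℝ M)

/-- The product of a positive definite `G` and a symmetric `H` has a least real eigenvalue. -/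
theorem isLeast_lambdaMin {d : ℕ} [NeZero d] {G H : Matrix (Fin d) (Fin d) ℝ}
    (hG : G.PosDef) (hH : H.IsHermitian) :
    IsLeast (spectrum ℝ (G * H)) (lambdaMin (G * H)) := by
  have hfin : (spectrum ℝ (G * H)).Finite := Matrix.finite_real_spectrum
  refine ⟨?_, fun x hx => csInf_le hfin.bddBelow hx⟩
  refine Set.Nonempty.csInf_mem ?_ hfin
  have hRR : CFC.sqrt G * CFC.sqrt G = G := CFC.sqrt_mul_sqrt_self G hG.posSemidef.nonneg
  have hR : (CFC.sqrt G).IsHermitian :=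
    (Matrix.nonneg_iff_posSemidef.1 (CFC.sqrt_nonneg G)).isHermitian
  have hu : IsUnit (CFC.sqrt G) := by
    rw [Matrix.isUnit_iff_isUnit_det]
    have h1 : IsUnit (CFC.sqrt G * CFC.sqrt G).det := by
      rw [hRR]; exact (Matrix.isUnit_iff_isUnit_det _).1 hG.isUnit
    rw [Matrix.det_mul] at h1
    exact isUnit_of_mul_isUnit_left h1
  obtain ⟨u, hu⟩ := hu
  have hB : (CFC.sqrt G * H * CFC.sqrt G).IsHermitian := by
    have := Matrix.isHermitian_conjTranspose_mul_mul (CFC.sqrt G) hH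
    rwa [hR.eq] at this
  have hconj : G * H = (u : Matrix (Fin d) (Fin d) ℝ) * (CFC.sqrt G * H * CFC.sqrt G) *
      ((u⁻¹ : (Matrix (Fin d) (Fin d) ℝ)ˣ) : Matrix (Fin d) (Fin d) ℝ) := by
    rw [Units.eq_mul_inv_iff_mul_eq, hu, ← mul_assoc, ← mul_assoc, hRR]
  rw [hconj, spectrum.units_conjugate, hB.spectrum_real_eq_range_eigenvalues]
  exact Set.range_nonempty _

/-- The quadratic loss `f(x) = c + (1/2) (x - a)ᵀ H (x - a)` with stationary point `a`. -/
noncomputable def quadLoss {d : ℕ} (c : ℝ) (a : Fin d → ℝ) (H : Matrix (Fin d) (Fin d) ℝ)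
    (x : Fin d → ℝ) : ℝ :=
  c + 1 / 2 * ((x - a) ⬝ᵥ (H *ᵥ (x - a)))

/-- A point `x` is a saddle point of the quadratic loss with Hessian `H` if it is a stationary
point and the Hessian has a negative eigenvalue. (A positive eigenvalue is not required.) -/
def IsSaddle {d : ℕ} (c : ℝ) (a : Fin d → ℝ) (H : Matrix (Fin d) (Fin d) ℝ)
    (x : Fin d → ℝ) : Prop :=
  HasFDerivAt (quadLoss c a H) (0 : (Fin d → ℝ) →L[ℝ] ℝ) x ∧ ∃ μ ∈ spectrum ℝ H, μ < 0

/-- A standard Brownian motion in `ℝᵈ`: the coordinates are independent real Brownian motions. -/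
structure IsBrownianVec {d : ℕ} {Ω : Type*} [MeasurableSpace Ω]
    (B : ℝ≥0 → Ω → Fin d → ℝ) (P : Measure Ω) : Prop where
  isBrownianReal : ∀ i, IsBrownianReal (fun t ω => B t ω i) P
  indep : iIndepFun (fun (i : Fin d) (ω : Ω) (t : ℝ≥0) => B t ω i) P

/-- `θ` is a (continuous) solution, started at the deterministic point `x₀`, of
`dθ = - G H (θ - a) dt + G S^{1/2} dB`. As the noise coefficient is constant, the stochastic
integral is `G S^{1/2} B`, and the integrated equation is required almost surely for all times. -/
structure IsOUProcess {d : ℕ} {Ω : Type*} [MeasurableSpace Ω]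
    (G H S : Matrix (Fin d) (Fin d) ℝ) (a x₀ : Fin d → ℝ)
    (B θ : ℝ≥0 → Ω → Fin d → ℝ) (P : Measure Ω) : Prop where
  continuous : ∀ᵐ ω ∂P, Continuous fun t => θ t ω
  equation : ∀ᵐ ω ∂P, ∀ t : ℝ≥0,
    θ t ω = x₀ - (∫ s in (0 : ℝ)..t, (G * H) *ᵥ (θ s.toNNReal ω - a))
      + (G * CFC.sqrt S) *ᵥ B t ω

/-- The escape time from `x₀`: the infimum of the times at which the expected loss is smaller than
the loss at `x₀`; it is `⊤` if there is no such time. -/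
noncomputable def escapeTime {d : ℕ} {Ω : Type*} [MeasurableSpace Ω]
    (f : (Fin d → ℝ) → ℝ) (x₀ : Fin d → ℝ) (θ : ℝ≥0 → Ω → Fin d → ℝ) (P : Measure Ω) : EReal :=
  sInf ((fun t : ℝ≥0 => ((t : ℝ) : EReal)) '' {t : ℝ≥0 | ∫ ω, f (θ t ω) ∂P < f x₀})

end PrecondLangevin

/-! The pair `G⁻¹`, `H` is diagonalized by one congruence: `U * G * Uᵀ = 1` and `H = Uᵀ * diagonal μ
* U`. The `μ i` are then the eigenvalues of `G * H`, and in the coordinates `z = U (θ - x₀)` the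
equation decouples into scalar Ornstein-Uhlenbeck equations with rates `μ i`, driven by Brownian
motions of variance rate `n i`, the diagonal of `N = U G S G Uᵀ`. Since the gradient vanishes at
`x₀`, the loss gain is `1/2 ∑ μ i * z i ^ 2`, and `μ i * E[z i ^ 2] = n i * (1 - exp (-2 μ i t)) /
2`, so `IsOUProcess.integral_quadLoss` gives the expected gain as `1/4 ∑ n i * (1 - exp (-2 μ i
t))`.

`N` is similar to `S * G`: hence `∑ n i = Tr (S G)` and `n i ≥ λ_min (S G) > 0`. Keeping only the
exponential of the most negative rate makes the gain negative once `exp (2 |λ_min (G H)| t) > Tr (S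
G) / λ_min (S G)`.

No Itô calculus is needed: the noise is additive, so variation of constants expresses each path by
time integrals of the Brownian path, and Fubini gives the moments from the covariance `min s t`. -/

namespace PrecondLangevin

/-! ### Measurable versions and exchange of expectation with time integrals -/

section Modification

variable {Ω : Type*} [MeasurableSpace Ω] {P : Measure Ω}

/-- A process with almost surely continuous paths is indistinguishable from a measurable process
all of whose paths are continuous. -/
theorem exists_continuous_modification {X : ℝ≥0 → Ω → ℝ} (hm : ∀ t, AEMeasurable (X t) P)
    (hc : ∀ᵐ ω ∂P, Continuous fun t => X t ω) :
    ∃ Y : ℝ≥0 → Ω → ℝ, (∀ t, Measurable (Y t)) ∧ (∀ ω, Continuous fun t => Y t ω) ∧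
      ∀ᵐ ω ∂P, ∀ t, X t ω = Y t ω := by
  obtain ⟨D, hDc, hDd⟩ := TopologicalSpace.exists_countable_dense ℝ≥0
  have hD : ∀ᵐ ω ∂P, (Continuous fun t => X t ω) ∧
      ∀ q ∈ D, X q ω = (hm q).mk _ ω := by
    refine hc.and ((ae_ball_iff hDc).2 fun q _ => (hm q).ae_eq_mk)
  -- Paths are set to zero off `E`. On `E` they agree with measurable versions at the dense times,
  -- and continuity carries measurability to all other times.
  obtain ⟨E, hEsub, hE, hEm⟩ := hD.exists_measurable_mem
  have hcont : ∀ ω, Continuous fun t => E.indicator (X t) ω := by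
    intro ω
    by_cases h : ω ∈ E
    · simpa [h] using (hEm ω h).1
    · simpa [h] using continuous_const
  refine ⟨fun t => E.indicator (X t), fun t => ?_, hcont, ?_⟩
  · have hq : ∀ q ∈ D, Measurable (E.indicator (X q)) := by
      intro q hqD
      have : E.indicator (X q) = E.indicator ((hm q).mk _) := by
        ext ω
        by_cases h : ω ∈ E
        · simpa [h] using (hEm ω h).2 q hqD
        · simp [h]
      rw [this]
      exact (hm q).measurable_mk.indicator hE
    obtain ⟨u, huD, hu⟩ := mem_closure_iff_seq_limit.1 (hDd t)
    refine measurable_of_tendsto_metrizable (fun n => hq (u n) (huD n)) ?_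
    rw [tendsto_pi_nhds]
    exact fun ω => ((hcont ω).tendsto t).comp hu
  · filter_upwards [hEsub] with ω hω t
    simp [Set.indicator_of_mem hω]

/-- Integrability on a product with a bounded interval from uniformly bounded first moments. -/
theorem integrable_prod_of_integral_norm_le [SFinite P] {F : ℝ → Ω → ℝ} {t C : ℝ}
    (hF : Measurable (Function.uncurry F))
    (hint : ∀ s ∈ Set.Ioc 0 t, Integrable (F s) P)
    (hC : ∀ s ∈ Set.Ioc 0 t, ∫ ω, ‖F s ω‖ ∂P ≤ C) :
    Integrable (Function.uncurry F) ((volume.restrict (Set.Ioc 0 t)).prod P) := by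
  rw [integrable_prod_iff hF.aestronglyMeasurable]
  refine ⟨(ae_restrict_iff' measurableSet_Ioc).2 (ae_of_all _ hint), ?_⟩
  refine Integrable.mono' (integrable_const C)
    (hF.norm.stronglyMeasurable.integral_prod_right (ν := P)).aestronglyMeasurable ?_
  refine (ae_restrict_iff' measurableSet_Ioc).2 (ae_of_all _ fun s hs => ?_)
  rw [Real.norm_of_nonneg (integral_nonneg fun _ => norm_nonneg _)]
  exact hC s hs

/-- Jensen's inequality for the square on a bounded interval. -/
theorem sq_integral_le {h : ℝ → ℝ} (hh : Continuous h) {t : ℝ} (ht : 0 ≤ t) :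
    (∫ s in (0 : ℝ)..t, h s) ^ 2 ≤ t * ∫ s in (0 : ℝ)..t, h s ^ 2 := by
  rcases ht.eq_or_lt with rfl | ht
  · simp
  set J := ∫ s in (0 : ℝ)..t, h s with hJ
  -- The variance of `h` about its mean `J / t` is nonnegative; expanding it gives the claim.
  have h0 : 0 ≤ ∫ s in (0 : ℝ)..t, (h s - J / t) ^ 2 :=
    intervalIntegral.integral_nonneg ht.le fun _ _ => sq_nonneg _
  have h1 : ∫ s in (0 : ℝ)..t, (h s - J / t) ^ 2
      = (∫ s in (0 : ℝ)..t, h s ^ 2) - 2 * (J / t) * J + t * (J / t) ^ 2 := by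
    have : ∀ s, (h s - J / t) ^ 2 = h s ^ 2 - 2 * (J / t) * h s + (J / t) ^ 2 := fun s => by ring
    simp_rw [this]
    rw [intervalIntegral.integral_add, intervalIntegral.integral_sub,
      intervalIntegral.integral_const_mul, intervalIntegral.integral_const, ← hJ]
    · simp
    all_goals exact Continuous.intervalIntegrable (by fun_prop) _ _
  rw [h1] at h0
  have h2 : (∫ s in (0 : ℝ)..t, h s ^ 2) - 2 * (J / t) * J + t * (J / t) ^ 2
      = (∫ s in (0 : ℝ)..t, h s ^ 2) - J ^ 2 / t := by
    field_simp; ring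
  rw [h2, sub_nonneg, div_le_iff₀ ht] at h0
  linarith

/-- Exchange of the expectation with a weighted time integral of a continuous process with
bounded second moments, tested against a square integrable variable. -/
theorem integral_mul_intervalIntegral [SFinite P] {Y : ℝ → Ω → ℝ} {g : ℝ → ℝ} {Z : Ω → ℝ}
    {t C : ℝ} (ht : 0 ≤ t) (hg : Continuous g) (hYm : ∀ s, Measurable (Y s))
    (hYc : ∀ ω, Continuous fun s => Y s ω) (hYL : ∀ s, MemLp (Y s) 2 P)
    (hYC : ∀ s ∈ Set.Ioc 0 t, ∫ ω, Y s ω ^ 2 ∂P ≤ C) (hZm : Measurable Z) (hZ : MemLp Z 2 P) :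
    ∫ ω, Z ω * (∫ s in (0 : ℝ)..t, g s * Y s ω) ∂P
      = ∫ s in (0 : ℝ)..t, g s * ∫ ω, Z ω * Y s ω ∂P := by
  obtain ⟨K, hK⟩ := (isCompact_Icc (a := (0 : ℝ)) (b := t)).exists_bound_of_continuousOn
    hg.continuousOn
  have hYu : Measurable (Function.uncurry Y) :=
    measurable_uncurry_of_continuous_of_measurable hYc hYm
  have hZY : ∀ s, Integrable (fun ω => Z ω * Y s ω) P := fun s => hZ.integrable_mul (hYL s)
  have hprod : Integrable (Function.uncurry fun s ω => g s * (Z ω * Y s ω))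
      ((volume.restrict (Set.Ioc 0 t)).prod P) := by
    refine integrable_prod_of_integral_norm_le (C := K * ((∫ ω, Z ω ^ 2 ∂P) + C)) ?_ ?_ ?_
    · exact (hg.measurable.comp measurable_fst).mul ((hZm.comp measurable_snd).mul hYu)
    · exact fun s _ => (hZY s).const_mul _
    · intro s hs
      have hgs : ‖g s‖ ≤ K := hK s ⟨hs.1.le, hs.2⟩
      have hK0 : 0 ≤ K := (norm_nonneg _).trans hgs
      simp_rw [norm_mul (g s)]
      rw [integral_const_mul]
      have h1 : ∫ ω, ‖Z ω * Y s ω‖ ∂P ≤ (∫ ω, Z ω ^ 2 ∂P) + C := by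
        calc ∫ ω, ‖Z ω * Y s ω‖ ∂P ≤ ∫ ω, (Z ω ^ 2 + Y s ω ^ 2) ∂P := by
              refine integral_mono (hZY s).norm (hZ.integrable_sq.add (hYL s).integrable_sq) ?_
              intro ω
              simp only [Real.norm_eq_abs]
              rw [abs_le]
              constructor <;> nlinarith [sq_nonneg (Z ω + Y s ω), sq_nonneg (Z ω - Y s ω)]
          _ = (∫ ω, Z ω ^ 2 ∂P) + ∫ ω, Y s ω ^ 2 ∂P :=
              integral_add hZ.integrable_sq (hYL s).integrable_sq
          _ ≤ _ := by gcongr; exact hYC s hs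
      exact mul_le_mul hgs h1 (integral_nonneg fun _ => norm_nonneg _) hK0
  have hswap := integral_integral_swap hprod
  simp only [intervalIntegral.integral_of_le ht]
  simp_rw [← integral_const_mul]
  rw [hswap]
  refine integral_congr_ae (ae_of_all _ fun ω => ?_)
  refine integral_congr_ae (ae_of_all _ fun s => ?_)
  simp only
  ring

/-- A weighted time integral of a continuous process with bounded second moments is square
integrable. -/
theorem memLp_intervalIntegral [SFinite P] {Y : ℝ → Ω → ℝ} {g : ℝ → ℝ}
    {t C : ℝ} (ht : 0 ≤ t) (hg : Continuous g) (hYm : ∀ s, Measurable (Y s))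
    (hYc : ∀ ω, Continuous fun s => Y s ω) (hYL : ∀ s, MemLp (Y s) 2 P)
    (hYC : ∀ s ∈ Set.Ioc 0 t, ∫ ω, Y s ω ^ 2 ∂P ≤ C) :
    (Measurable fun ω => ∫ s in (0 : ℝ)..t, g s * Y s ω) ∧
      MemLp (fun ω => ∫ s in (0 : ℝ)..t, g s * Y s ω) 2 P := by
  obtain ⟨K, hK⟩ := (isCompact_Icc (a := (0 : ℝ)) (b := t)).exists_bound_of_continuousOn
    (hg.pow 2).continuousOn
  have hYu : Measurable (Function.uncurry Y) :=
    measurable_uncurry_of_continuous_of_measurable hYc hYm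
  have hJm : Measurable fun ω => ∫ s in (0 : ℝ)..t, g s * Y s ω := by
    simp only [intervalIntegral.integral_of_le ht]
    refine (StronglyMeasurable.integral_prod_left' (μ := volume.restrict (Set.Ioc 0 t))
      (f := fun p : ℝ × Ω => g p.1 * Y p.1 p.2) ?_).measurable
    exact ((hg.measurable.comp measurable_fst).mul hYu).stronglyMeasurable
  refine ⟨hJm, (memLp_two_iff_integrable_sq hJm.aestronglyMeasurable).2 ?_⟩
  have hprod : Integrable (Function.uncurry fun s ω => g s ^ 2 * Y s ω ^ 2)
      ((volume.restrict (Set.Ioc 0 t)).prod P) := by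
    refine integrable_prod_of_integral_norm_le (C := K * C) ?_ ?_ ?_
    · exact ((hg.measurable.comp measurable_fst).pow_const 2).mul (hYu.pow_const 2)
    · exact fun s _ => (hYL s).integrable_sq.const_mul _
    · intro s hs
      have hgs : ‖g s ^ 2‖ ≤ K := hK s ⟨hs.1.le, hs.2⟩
      simp_rw [norm_mul (g s ^ 2)]
      rw [integral_const_mul]
      refine mul_le_mul hgs ?_ (integral_nonneg fun _ => norm_nonneg _)
        ((norm_nonneg _).trans hgs)
      simpa using hYC s hs
  refine (hprod.integral_prod_right.const_mul t).mono' (hJm.pow_const 2).aestronglyMeasurable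
    (ae_of_all _ fun ω => ?_)
  have := sq_integral_le (h := fun s => g s * Y s ω) (hg.mul (hYc ω)) ht
  rw [Real.norm_of_nonneg (sq_nonneg _)]
  refine this.trans_eq ?_
  simp only [intervalIntegral.integral_of_le ht, Function.uncurry, mul_pow]

end Modification

/-! ### The scalar Ornstein-Uhlenbeck equation and its second moment -/

section Scalar

/-- The solution of the integral equation `w = b - m ∫ w` by variation of constants. -/
theorem eq_of_integral_equation {w b : ℝ → ℝ} {m : ℝ} (hw : Continuous w) (hb : Continuous b)
    (h : ∀ t, 0 ≤ t → w t = -(m * ∫ s in (0 : ℝ)..t, w s) + b t) {t : ℝ} (ht : 0 ≤ t) :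
    w t = b t - m * Real.exp (-(m * t)) * ∫ s in (0 : ℝ)..t, Real.exp (m * s) * b s := by
  have hI : ∀ x, HasDerivAt (fun u => ∫ s in (0 : ℝ)..u, w s) (w x) x := fun x =>
    intervalIntegral.integral_hasDerivAt_right (hw.intervalIntegrable _ _)
      hw.stronglyMeasurable.stronglyMeasurableAtFilter hw.continuousAt
  have hE : ∀ x, HasDerivAt (fun u => Real.exp (m * u)) (Real.exp (m * x) * m) x := fun x => by
    simpa using ((hasDerivAt_id x).const_mul m).exp
  -- Integrating factor: by the equation, `exp (m u) * ∫ w` has derivative `exp (m u) * b u`.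
  have key : ∫ s in (0 : ℝ)..t, Real.exp (m * s) * b s
      = Real.exp (m * t) * ∫ s in (0 : ℝ)..t, w s := by
    rw [intervalIntegral.integral_eq_sub_of_hasDerivAt
      (f := fun u => Real.exp (m * u) * ∫ s in (0 : ℝ)..u, w s)]
    · simp
    · intro x hx
      rw [Set.uIcc_of_le ht] at hx
      refine ((hE x).mul (hI x)).congr_deriv ?_
      rw [h x hx.1]
      ring
    · exact Continuous.intervalIntegrable (by fun_prop) _ _
  rw [key, h t ht, Real.exp_neg]
  field_simp
  ring

/-- Splitting at `r = s` removes the minimum. With `J = ∫ exp (m r) * Y r` this is `E[Y s * J]` per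
unit variance. -/
theorem integral_exp_mul_min {m : ℝ} (hm : m ≠ 0) {s t : ℝ} (hs : 0 ≤ s) (hst : s ≤ t) :
    ∫ r in (0 : ℝ)..t, Real.exp (m * r) * min s r
      = s * Real.exp (m * t) / m - (Real.exp (m * s) - 1) / m ^ 2 := by
  have hE : ∀ x, HasDerivAt (fun u => Real.exp (m * u)) (Real.exp (m * x) * m) x := fun x => by
    simpa using ((hasDerivAt_id x).const_mul m).exp
  have hc : Continuous fun r => Real.exp (m * r) * min s r := by fun_prop
  rw [← intervalIntegral.integral_add_adjacent_intervals (hc.intervalIntegrable 0 s)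
    (hc.intervalIntegrable s t)]
  have h1 : ∫ r in (0 : ℝ)..s, Real.exp (m * r) * min s r
      = ∫ r in (0 : ℝ)..s, Real.exp (m * r) * r := by
    refine intervalIntegral.integral_congr fun r hr => ?_
    rw [Set.uIcc_of_le hs] at hr
    simp [min_eq_right hr.2]
  have h2 : ∫ r in s..t, Real.exp (m * r) * min s r = ∫ r in s..t, Real.exp (m * r) * s := by
    refine intervalIntegral.integral_congr fun r hr => ?_
    rw [Set.uIcc_of_le hst] at hr
    simp [min_eq_left hr.1]
  have h3 : ∫ r in (0 : ℝ)..s, Real.exp (m * r) * r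
      = (Real.exp (m * s) * s / m - Real.exp (m * s) / m ^ 2) -
        (Real.exp (m * 0) * 0 / m - Real.exp (m * 0) / m ^ 2) := by
    refine intervalIntegral.integral_eq_sub_of_hasDerivAt
      (f := fun r => Real.exp (m * r) * r / m - Real.exp (m * r) / m ^ 2) (fun x _ => ?_)
      (Continuous.intervalIntegrable (by fun_prop) _ _)
    refine ((((hE x).mul (hasDerivAt_id x)).div_const m).sub
      ((hE x).div_const (m ^ 2))).congr_deriv ?_
    simp only [id]
    field_simp
    ring
  have h4 : ∫ r in s..t, Real.exp (m * r) * s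
      = Real.exp (m * t) * s / m - Real.exp (m * s) * s / m := by
    refine intervalIntegral.integral_eq_sub_of_hasDerivAt
      (f := fun r => Real.exp (m * r) * s / m) (fun x _ => ?_)
      (Continuous.intervalIntegrable (by fun_prop) _ _)
    refine (((hE x).mul_const s).div_const m).congr_deriv ?_
    field_simp
  rw [h1, h2, h3, h4]
  simp only [mul_zero, Real.exp_zero]
  ring

/-- Integrating the previous kernel once more against `exp (m s)` yields `E[J ^ 2]` per unit
variance. -/
theorem integral_exp_mul_kernel {m : ℝ} (hm : m ≠ 0) (t : ℝ) :
    ∫ s in (0 : ℝ)..t, Real.exp (m * s) *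
        (s * Real.exp (m * t) / m - (Real.exp (m * s) - 1) / m ^ 2)
      = (t * Real.exp (m * t) ^ 2 / m ^ 2 - (Real.exp (m * t) - 1) * Real.exp (m * t) / m ^ 3)
        - (Real.exp (m * t) ^ 2 - 1) / (2 * m ^ 3) + (Real.exp (m * t) - 1) / m ^ 3 := by
  have hE : ∀ x, HasDerivAt (fun u => Real.exp (m * u)) (Real.exp (m * x) * m) x := fun x => by
    simpa using ((hasDerivAt_id x).const_mul m).exp
  rw [intervalIntegral.integral_eq_sub_of_hasDerivAt
      (f := fun s => (Real.exp (m * s) * s / m - Real.exp (m * s) / m ^ 2) * (Real.exp (m * t) / m)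
        - Real.exp (m * s) ^ 2 / (2 * m ^ 3) + Real.exp (m * s) / m ^ 3)]
  · simp only [mul_zero, Real.exp_zero]
    field_simp
    ring
  · intro x _
    refine (((((((hE x).mul (hasDerivAt_id x)).div_const m).sub
      ((hE x).div_const (m ^ 2))).mul_const (Real.exp (m * t) / m)).sub
      (((hE x).pow 2).div_const (2 * m ^ 3))).add ((hE x).div_const (m ^ 3))).congr_deriv ?_
    simp only [id]
    field_simp
    ring
  · exact Continuous.intervalIntegrable (by fun_prop) _ _

variable {Ω : Type*} [MeasurableSpace Ω] {P : Measure Ω}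

/-- The second moment of the variation of constants formula driven by a process with the covariance
of a Brownian motion of variance `n`. -/
theorem integral_sq_variation [SFinite P] {Y : ℝ → Ω → ℝ} {m n : ℝ} (hn : 0 ≤ n)
    (hYm : ∀ s, Measurable (Y s)) (hYc : ∀ ω, Continuous fun s => Y s ω)
    (hYL : ∀ s, MemLp (Y s) 2 P)
    (hcov : ∀ s t, 0 ≤ s → 0 ≤ t → ∫ ω, Y s ω * Y t ω ∂P = n * min s t) {t : ℝ} (ht : 0 ≤ t) :
    MemLp (fun ω => Y t ω - m * Real.exp (-(m * t)) *
        ∫ s in (0 : ℝ)..t, Real.exp (m * s) * Y s ω) 2 P ∧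
    m * ∫ ω, (Y t ω - m * Real.exp (-(m * t)) *
        ∫ s in (0 : ℝ)..t, Real.exp (m * s) * Y s ω) ^ 2 ∂P
      = n * (1 - Real.exp (-(2 * m * t))) / 2 := by
  have hg : Continuous fun s : ℝ => Real.exp (m * s) := by fun_prop
  have hYC : ∀ s ∈ Set.Ioc 0 t, ∫ ω, Y s ω ^ 2 ∂P ≤ n * t := by
    intro s hs
    simp_rw [sq]
    rw [hcov s s hs.1.le hs.1.le, min_self]
    exact mul_le_mul_of_nonneg_left hs.2 hn
  obtain ⟨hJm, hJL⟩ := memLp_intervalIntegral ht hg hYm hYc hYL hYC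
  refine ⟨(hYL t).sub (hJL.const_mul _), ?_⟩
  -- The kernel formulas divide by `m`; for `m = 0` both sides vanish.
  rcases eq_or_ne m 0 with rfl | hm
  · simp
  have hYJ : ∀ s, 0 ≤ s → s ≤ t → ∫ ω, Y s ω * (∫ r in (0 : ℝ)..t, Real.exp (m * r) * Y r ω) ∂P
      = n * (s * Real.exp (m * t) / m - (Real.exp (m * s) - 1) / m ^ 2) := by
    intro s hs hst
    rw [integral_mul_intervalIntegral ht hg hYm hYc hYL hYC (hYm s) (hYL s),
      ← integral_exp_mul_min hm hs hst, ← intervalIntegral.integral_const_mul]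
    refine intervalIntegral.integral_congr fun r hr => ?_
    rw [Set.uIcc_of_le ht] at hr
    simp only [hcov s r hs hr.1]
    ring
  have hJJ : ∫ ω, (∫ r in (0 : ℝ)..t, Real.exp (m * r) * Y r ω) *
        (∫ r in (0 : ℝ)..t, Real.exp (m * r) * Y r ω) ∂P
      = n * ((t * Real.exp (m * t) ^ 2 / m ^ 2 - (Real.exp (m * t) - 1) * Real.exp (m * t) / m ^ 3)
        - (Real.exp (m * t) ^ 2 - 1) / (2 * m ^ 3) + (Real.exp (m * t) - 1) / m ^ 3) := by
    rw [integral_mul_intervalIntegral ht hg hYm hYc hYL hYC hJm hJL,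
      ← integral_exp_mul_kernel hm, ← intervalIntegral.integral_const_mul]
    refine intervalIntegral.integral_congr fun s hs => ?_
    rw [Set.uIcc_of_le ht] at hs
    have := hYJ s hs.1 hs.2
    simp_rw [mul_comm (Y s _)] at this
    simp only [this]
    ring
  have hexp : ∀ (y J e : ℝ), (y - m * e * J) ^ 2
      = y * y - 2 * m * e * (y * J) + m ^ 2 * e ^ 2 * (J * J) := fun y J e => by ring
  simp_rw [hexp]
  have i1 : Integrable (fun ω => Y t ω * Y t ω) P := (hYL t).integrable_mul (hYL t)
  have i2 := ((hYL t).integrable_mul hJL).const_mul (2 * m * Real.exp (-(m * t)))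
  have i3 := (hJL.integrable_mul hJL).const_mul (m ^ 2 * Real.exp (-(m * t)) ^ 2)
  simp only [Pi.mul_apply] at i2 i3
  have i12 : Integrable (fun ω => Y t ω * Y t ω - 2 * m * Real.exp (-(m * t)) *
      (Y t ω * ∫ s in (0 : ℝ)..t, Real.exp (m * s) * Y s ω)) P := i1.sub i2
  rw [integral_add i12 i3, integral_sub i1 i2, integral_const_mul,
    integral_const_mul, hYJ t ht le_rfl, hJJ, hcov t t ht ht, min_self]
  have e2 : Real.exp (-(2 * m * t)) = (Real.exp (m * t))⁻¹ ^ 2 := by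
    rw [← Real.exp_neg, ← Real.exp_nat_mul]
    congr 1
    push_cast
    ring
  rw [e2, Real.exp_neg]
  have := Real.exp_ne_zero (m * t)
  field_simp
  ring

/-- Second moments of a scalar Ornstein-Uhlenbeck process: if `w = b - m ∫ w` and `b` has the
covariance of a Brownian motion of variance `n`, then `m E[w²] = n (1 - exp (-2 m t)) / 2`. -/
theorem scalar_second_moment [SFinite P] {w b : ℝ≥0 → Ω → ℝ} {m n : ℝ} (hn : 0 ≤ n)
    (hw : ∀ᵐ ω ∂P, Continuous fun t => w t ω) (hb : ∀ᵐ ω ∂P, Continuous fun t => b t ω)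
    (heq : ∀ᵐ ω ∂P, ∀ t : ℝ≥0, w t ω = -(m * ∫ s in (0 : ℝ)..t, w s.toNNReal ω) + b t ω)
    (hbL : ∀ t, MemLp (b t) 2 P)
    (hcov : ∀ s t : ℝ≥0, ∫ ω, b s ω * b t ω ∂P = n * min (s : ℝ) t) (t : ℝ≥0) :
    MemLp (w t) 2 P ∧
      m * ∫ ω, w t ω ^ 2 ∂P = n * (1 - Real.exp (-(2 * m * t))) / 2 := by
  obtain ⟨Y, hYm, hYc, hYb⟩ := exists_continuous_modification
    (fun t => (hbL t).aestronglyMeasurable.aemeasurable) hb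
  have hbY : ∀ t, b t =ᵐ[P] Y t := fun t => hYb.mono fun ω h => h t
  have key := integral_sq_variation (P := P) (Y := fun s => Y s.toNNReal) (m := m) hn
    (fun s => hYm _) (fun ω => (hYc ω).comp continuous_real_toNNReal)
    (fun s => (memLp_congr_ae (hbY _)).1 (hbL _)) (fun s t hs ht => by
      have := hcov s.toNNReal t.toNNReal
      rw [Real.coe_toNNReal s hs, Real.coe_toNNReal t ht] at this
      rw [← this]
      refine integral_congr_ae ?_
      filter_upwards [hYb] with ω h
      rw [h, h]) t.coe_nonneg
  have hwY : w t =ᵐ[P] fun ω => Y (t : ℝ).toNNReal ω - m * Real.exp (-(m * t)) *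
        ∫ s in (0 : ℝ)..t, Real.exp (m * s) * Y s.toNNReal ω := by
    filter_upwards [hw, heq, hYb] with ω h1 h2 h3
    have := eq_of_integral_equation (w := fun s => w s.toNNReal ω) (b := fun s => Y s.toNNReal ω)
      (m := m) (h1.comp continuous_real_toNNReal) ((hYc ω).comp continuous_real_toNNReal)
      (fun s hs => by
        have := h2 s.toNNReal
        rw [Real.coe_toNNReal s hs, h3] at this
        exact this) t.coe_nonneg
    simpa using this
  -- Measurability of `w t` is not assumed; it comes from the explicit formula.
  refine ⟨(memLp_congr_ae hwY).2 key.1, ?_⟩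
  rw [← key.2]
  congr 1
  refine integral_congr_ae ?_
  filter_upwards [hwY] with ω h
  rw [h]

end Scalar

/-! ### Covariance of linear functionals of vector Brownian motion -/

section BrownianVec

variable {d : ℕ} {Ω : Type*} [MeasurableSpace Ω] {P : Measure Ω} {B : ℝ≥0 → Ω → Fin d → ℝ}

theorem IsBrownianVec.memLp (hB : IsBrownianVec B P) (t : ℝ≥0) (i : Fin d) :
    MemLp (fun ω => B t ω i) 2 P :=
  ((hB.isBrownianReal i).hasLaw_eval t).hasGaussianLaw.memLp_two

theorem IsBrownianVec.integral_mul [IsProbabilityMeasure P] (hB : IsBrownianVec B P) (s t : ℝ≥0)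
    (i j : Fin d) :
    ∫ ω, B s ω i * B t ω j ∂P = if i = j then min (s : ℝ) t else 0 := by
  have hi := (hB.isBrownianReal i).integral_eval
  have hj := (hB.isBrownianReal j).integral_eval
  split_ifs with h
  · subst h
    have h1 := covariance_eq_sub (hB.memLp s i) (hB.memLp t i)
    rw [hi s, zero_mul, sub_zero, (hB.isBrownianReal i).covariance_eval] at h1
    simpa using h1.symm
  · have hind : IndepFun (fun ω => B s ω i) (fun ω => B t ω j) P :=
      (hB.indep.indepFun h).comp (measurable_pi_apply s) (measurable_pi_apply t)
    rw [hind.integral_fun_mul_eq_mul_integral (hB.memLp s i).aestronglyMeasurable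
      (hB.memLp t j).aestronglyMeasurable, hi s, zero_mul]

theorem IsBrownianVec.memLp_dotProduct (hB : IsBrownianVec B P) (q : Fin d → ℝ) (t : ℝ≥0) :
    MemLp (fun ω => q ⬝ᵥ B t ω) 2 P :=
  memLp_finsetSum _ fun i _ => (hB.memLp t i).const_mul (q i)

theorem IsBrownianVec.integral_dotProduct_mul [IsProbabilityMeasure P] (hB : IsBrownianVec B P)
    (q : Fin d → ℝ) (s t : ℝ≥0) :
    ∫ ω, (q ⬝ᵥ B s ω) * (q ⬝ᵥ B t ω) ∂P = (q ⬝ᵥ q) * min (s : ℝ) t := by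
  have hint : ∀ i j, Integrable (fun ω => q i * B s ω i * (q j * B t ω j)) P := fun i j =>
    ((hB.memLp s i).const_mul (q i)).integrable_mul ((hB.memLp t j).const_mul (q j))
  simp only [dotProduct, Finset.sum_mul_sum]
  rw [integral_finsetSum _ fun i _ => integrable_finsetSum _ fun j _ => hint i j, Finset.sum_mul]
  refine Finset.sum_congr rfl fun i _ => ?_
  have hij : ∀ j, ∫ ω, q i * B s ω i * (q j * B t ω j) ∂P
      = q i * q j * if i = j then min (s : ℝ) t else 0 := fun j => by
    rw [← hB.integral_mul, ← integral_const_mul]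
    exact integral_congr_ae (ae_of_all _ fun ω => mul_mul_mul_comm _ _ _ _)
  rw [integral_finsetSum _ fun j _ => hint i j]
  simp [hij]

theorem IsBrownianVec.continuous (hB : IsBrownianVec B P) :
    ∀ᵐ ω ∂P, Continuous fun t => B t ω := by
  have : ∀ᵐ ω ∂P, ∀ i, Continuous fun t => B t ω i :=
    ae_all_iff.2 fun i => (hB.isBrownianReal i).cont
  exact this.mono fun ω h => continuous_pi h

end BrownianVec

/-! ### Simultaneous diagonalization and the spectra of `G * H` and `S * G` -/

section Diagonalization

variable {d : ℕ} {G H S U : Matrix (Fin d) (Fin d) ℝ} {μ : Fin d → ℝ}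

/-- A positive definite matrix and a symmetric matrix are simultaneously diagonalized by a
congruence. -/
theorem exists_simultaneous_diagonalization (hG : G.PosDef) (hH : H.IsHermitian) :
    ∃ (U : Matrix (Fin d) (Fin d) ℝ) (μ : Fin d → ℝ),
      H = Uᵀ * diagonal μ * U ∧ U * G * Uᵀ = 1 := by
  set R := CFC.sqrt G
  have hRR : R * R = G := CFC.sqrt_mul_sqrt_self G hG.posSemidef.nonneg
  have hR : R.IsHermitian := (Matrix.nonneg_iff_posSemidef.1 (CFC.sqrt_nonneg G)).isHermitian
  have hRT : Rᵀ = R := by simpa using hR.eq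
  have hu : IsUnit R.det := by
    have h1 : IsUnit (R * R).det := by
      rw [hRR]; exact (Matrix.isUnit_iff_isUnit_det _).1 hG.isUnit
    rw [Matrix.det_mul] at h1
    exact isUnit_of_mul_isUnit_left h1
  have hA : (R * H * R).IsHermitian := by
    have := Matrix.isHermitian_conjTranspose_mul_mul R hH
    rwa [hR.eq] at this
  set V : Matrix (Fin d) (Fin d) ℝ := hA.eigenvectorUnitary.1
  have hVV : Vᵀ * V = 1 := by
    simpa [star_eq_conjTranspose] using Unitary.coe_star_mul_self hA.eigenvectorUnitary
  have hsp : R * H * R = V * diagonal hA.eigenvalues * Vᵀ := by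
    have := hA.spectral_theorem
    rw [Unitary.conjStarAlgAut_apply] at this
    simpa [star_eq_conjTranspose, Function.comp_def] using this
  have hRi : R⁻¹ * R = 1 := nonsing_inv_mul _ hu
  have hRi' : R * R⁻¹ = 1 := mul_nonsing_inv _ hu
  have hRiT : (R⁻¹)ᵀ = R⁻¹ := by rw [transpose_nonsing_inv, hRT]
  -- `R⁻¹` turns `G = R * R` into the identity, and the orthogonal `Vᵀ` then diagonalizes `R * H *
  -- R` without disturbing it.
  refine ⟨Vᵀ * R⁻¹, hA.eigenvalues, ?_, ?_⟩
  · calc H = R⁻¹ * (R * H * R) * R⁻¹ := by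
          rw [← mul_assoc, ← mul_assoc, hRi, one_mul, mul_assoc, hRi', mul_one]
      _ = R⁻¹ * (V * diagonal hA.eigenvalues * Vᵀ) * R⁻¹ := congrArg (R⁻¹ * · * R⁻¹) hsp
      _ = _ := by
          rw [transpose_mul, transpose_transpose, hRiT]
          simp only [mul_assoc]
  · rw [transpose_mul, transpose_transpose, hRiT, ← hRR]
    calc Vᵀ * R⁻¹ * (R * R) * (R⁻¹ * V) = Vᵀ * ((R⁻¹ * R) * (R * R⁻¹)) * V := by
          simp only [mul_assoc]
      _ = 1 := by rw [hRi, hRi', mul_one, mul_one, hVV]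

/-- `G * Uᵀ` is the inverse of `U`, so `G * H` is conjugate to `diagonal μ`. -/
theorem spectrum_eq_range_of_congruence (hH : H = Uᵀ * diagonal μ * U) (hU : U * G * Uᵀ = 1) :
    spectrum ℝ (G * H) = Set.range μ := by
  have hGU : G * Uᵀ * U = 1 := by
    rw [mul_eq_one_comm, ← mul_assoc]; exact hU
  let u : (Matrix (Fin d) (Fin d) ℝ)ˣ := ⟨G * Uᵀ, U, hGU, mul_eq_one_comm.1 hGU⟩
  have : G * H = (u : Matrix (Fin d) (Fin d) ℝ) * diagonal μ *
      ((u⁻¹ : (Matrix (Fin d) (Fin d) ℝ)ˣ) : Matrix (Fin d) (Fin d) ℝ) := by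
    rw [hH]
    change _ = G * Uᵀ * diagonal μ * U
    simp only [mul_assoc]
  rw [this, spectrum.units_conjugate, spectrum_diagonal]

theorem mul_mul_eq_of_congruence (hH : H = Uᵀ * diagonal μ * U) (hU : U * G * Uᵀ = 1) :
    U * (G * H) = diagonal μ * U := by
  rw [hH, ← mul_assoc, ← mul_assoc, ← mul_assoc, hU, one_mul]

/-- `U * G` and `Uᵀ` are mutually inverse, so this symmetric matrix is a conjugate of `S * G`. -/
theorem spectrum_congruence (hU : U * G * Uᵀ = 1) :
    spectrum ℝ (U * G * S * G * Uᵀ) = spectrum ℝ (S * G) := by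
  let u : (Matrix (Fin d) (Fin d) ℝ)ˣ := ⟨U * G, Uᵀ, hU, mul_eq_one_comm.1 hU⟩
  have : U * G * S * G * Uᵀ = (u : Matrix (Fin d) (Fin d) ℝ) * (S * G) *
      ((u⁻¹ : (Matrix (Fin d) (Fin d) ℝ)ˣ) : Matrix (Fin d) (Fin d) ℝ) := by
    change _ = U * G * (S * G) * Uᵀ
    simp only [mul_assoc]
  rw [this, spectrum.units_conjugate]

theorem trace_congruence (hU : U * G * Uᵀ = 1) : (U * G * S * G * Uᵀ).trace = (S * G).trace := by
  have hU' : Uᵀ * (U * G) = 1 := mul_eq_one_comm.1 hU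
  rw [show U * G * S * G * Uᵀ = U * G * (S * G) * Uᵀ by simp only [mul_assoc], trace_mul_comm,
    ← mul_assoc, hU', one_mul]

theorem isHermitian_congruence (hG : G.IsHermitian) (hS : S.IsHermitian) :
    (U * G * S * G * Uᵀ).IsHermitian := by
  have := isHermitian_mul_mul_conjTranspose (U * G) hS
  rwa [conjTranspose_mul, hG.eq, conjTranspose_eq_transpose_of_trivial, ← mul_assoc] at this

/-- A symmetric matrix dominates its least eigenvalue times the identity in the Loewner order, and
diagonal entries respect that order. -/
theorem lambdaMin_le_diag (hG : G.PosDef) (hS : S.PosDef) (hU : U * G * Uᵀ = 1) (i : Fin d) :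
    lambdaMin (S * G) ≤ (U * G * S * G * Uᵀ) i i := by
  have : NeZero d := ⟨fun h => (h ▸ i).elim0⟩
  have hleast := isLeast_lambdaMin hS hG.isHermitian
  have hN := isHermitian_congruence (U := U) hG.isHermitian hS.isHermitian
  have h1 : algebraMap ℝ (Matrix (Fin d) (Fin d) ℝ) (lambdaMin (S * G)) ≤ U * G * S * G * Uᵀ := by
    refine algebraMap_le_of_le_spectrum (fun x hx => ?_) hN
    rw [spectrum_congruence hU] at hx
    exact hleast.2 hx
  have h2 := (Matrix.le_iff.1 h1).diag_nonneg (i := i)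
  simpa [algebraMap_matrix_apply] using h2

/-- Diagonalizing with `S` in the role of `G` makes the eigenvalues of `S * G` the entries of a
diagonal matrix congruent to `G`, hence positive definite. -/
theorem lambdaMin_pos [NeZero d] (hG : G.PosDef) (hS : S.PosDef) : 0 < lambdaMin (S * G) := by
  obtain ⟨U, μ, hGU, hU⟩ := exists_simultaneous_diagonalization hS hG.isHermitian
  have hmem := (isLeast_lambdaMin hS hG.isHermitian).1
  rw [spectrum_eq_range_of_congruence hGU hU] at hmem
  obtain ⟨i, hi⟩ := hmem
  have hUu : IsUnit U := by
    refine IsUnit.of_mul_eq_one (S * Uᵀ) (by rw [← mul_assoc, hU])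
  have hD : (diagonal μ).PosDef := by
    refine hUu.posDef_star_left_conjugate_iff.1 ?_
    rw [star_eq_conjTranspose, conjTranspose_eq_transpose_of_trivial, ← hGU]
    exact hG
  rw [← hi]
  exact (posDef_diagonal_iff.1 hD) i

/-- Congruence preserves semidefiniteness: were the least `μ i` nonnegative, `H` would be positive
semidefinite and have no negative eigenvalue. -/
theorem exists_eq_lambdaMin_neg (hH : H = Uᵀ * diagonal μ * U) (hU : U * G * Uᵀ = 1)
    (hG : G.PosDef) (hneg : ∃ x ∈ spectrum ℝ H, x < 0) :
    ∃ i, μ i = lambdaMin (G * H) ∧ μ i < 0 := by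
  obtain ⟨x, hx, hx0⟩ := hneg
  have hnz : NeZero d := by
    refine ⟨?_⟩
    rintro rfl
    simp [spectrum.of_subsingleton] at hx
  have hHh : H.IsHermitian := by
    rw [hH]
    have := isHermitian_conjTranspose_mul_mul U (isHermitian_diagonal μ)
    simpa using this
  have hleast := isLeast_lambdaMin hG hHh
  have hsp := spectrum_eq_range_of_congruence hH hU
  rw [hsp] at hleast
  obtain ⟨i, hi⟩ := hleast.1
  refine ⟨i, hi, ?_⟩
  by_contra! h0
  have hps : H.PosSemidef := by
    have hD : (diagonal μ).PosSemidef := PosSemidef.diagonal fun j =>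
      h0.trans (hi.le.trans (hleast.2 ⟨j, rfl⟩))
    have := hD.conjTranspose_mul_mul_same U
    rw [hH]
    simpa using this
  rw [hHh.spectrum_real_eq_range_eigenvalues] at hx
  obtain ⟨j, hj⟩ := hx
  exact absurd (hps.eigenvalues_nonneg j) (by rw [hj]; exact not_le.2 hx0)

end Diagonalization

/-! ### The loss around a stationary point -/

section Loss

variable {d : ℕ} {H U : Matrix (Fin d) (Fin d) ℝ} {c : ℝ} {a x₀ : Fin d → ℝ} {μ : Fin d → ℝ}

theorem quadLoss_add (hH : H.IsSymm) (z : Fin d → ℝ) :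
    quadLoss c a H (x₀ + z) = quadLoss c a H x₀ + z ⬝ᵥ (H *ᵥ (x₀ - a)) +
      1 / 2 * (z ⬝ᵥ (H *ᵥ z)) := by
  have h1 : x₀ + z - a = (x₀ - a) + z := by abel
  have h2 : (x₀ - a) ⬝ᵥ (H *ᵥ z) = z ⬝ᵥ (H *ᵥ (x₀ - a)) := by
    rw [dotProduct_mulVec, ← mulVec_transpose, hH.eq, dotProduct_comm]
  simp only [quadLoss, h1, mulVec_add, add_dotProduct, dotProduct_add, h2]
  ring

/-- At a stationary point of the quadratic loss the gradient `H (x - a)` vanishes. -/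
theorem mulVec_eq_zero_of_hasFDerivAt (hH : H.IsSymm)
    (h : HasFDerivAt (quadLoss c a H) (0 : (Fin d → ℝ) →L[ℝ] ℝ) x₀) : H *ᵥ (x₀ - a) = 0 := by
  refine dotProduct_eq_zero _ fun v => ?_
  rw [dotProduct_comm]
  have h1 : HasDerivAt (fun s : ℝ => quadLoss c a H (x₀ + s • v)) 0 0 := by
    have hl : HasDerivAt (fun s : ℝ => x₀ + s • v) ((1 : ℝ) • v) 0 :=
      ((hasDerivAt_id (0 : ℝ)).smul_const v).const_add x₀
    have h' : HasFDerivAt (quadLoss c a H) (0 : (Fin d → ℝ) →L[ℝ] ℝ) (x₀ + (0 : ℝ) • v) := by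
      simpa using h
    exact h'.comp_hasDerivAt (0 : ℝ) hl
  have h2 : HasDerivAt (fun s : ℝ => quadLoss c a H (x₀ + s • v)) (v ⬝ᵥ (H *ᵥ (x₀ - a))) 0 := by
    have : (fun s : ℝ => quadLoss c a H (x₀ + s • v)) = fun s : ℝ => quadLoss c a H x₀ +
        s * (v ⬝ᵥ (H *ᵥ (x₀ - a))) + s ^ 2 * (1 / 2 * (v ⬝ᵥ (H *ᵥ v))) := by
      ext s
      rw [quadLoss_add hH]
      simp only [mulVec_smul, smul_dotProduct, dotProduct_smul, smul_eq_mul]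
      ring
    rw [this]
    refine ((((hasDerivAt_id (0 : ℝ)).mul_const _).const_add _).add
      (((hasDerivAt_id (0 : ℝ)).pow 2).mul_const _)).congr_deriv ?_
    simp
  exact h2.unique h1

/-- The quadratic loss around a stationary point in diagonalizing coordinates. -/
theorem quadLoss_eq_sum (hH : H.IsSymm) (hd : H = Uᵀ * diagonal μ * U)
    (h0 : H *ᵥ (x₀ - a) = 0) (x : Fin d → ℝ) :
    quadLoss c a H x = quadLoss c a H x₀ + 1 / 2 * ∑ i, μ i * (U *ᵥ (x - x₀)) i ^ 2 := by
  have h1 := quadLoss_add (c := c) (a := a) (x₀ := x₀) hH (x - x₀)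
  rw [add_sub_cancel, h0, dotProduct_zero, add_zero] at h1
  rw [h1]
  congr 2
  have : H *ᵥ (x - x₀) = Uᵀ *ᵥ (diagonal μ *ᵥ (U *ᵥ (x - x₀))) := by
    rw [hd, mulVec_mulVec, mulVec_mulVec, mul_assoc]
  rw [this, dotProduct_mulVec, vecMul_transpose]
  simp only [dotProduct, mulVec_diagonal]
  exact Finset.sum_congr rfl fun i _ => by ring

end Loss

/-! ### Decoupled coordinates and the expected loss -/

section Coordinates

variable {d : ℕ} {Ω : Type*} [MeasurableSpace Ω] {P : Measure Ω}
  {G H S U : Matrix (Fin d) (Fin d) ℝ} {μ : Fin d → ℝ} {a x₀ : Fin d → ℝ}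
  {B θ : ℝ≥0 → Ω → Fin d → ℝ}

/-- In diagonalizing coordinates the process solves decoupled scalar equations. -/
theorem IsOUProcess.coordinate_equation (hθ : IsOUProcess G H S a x₀ B θ P)
    (hU : U * (G * H) = diagonal μ * U) (h0 : H *ᵥ (x₀ - a) = 0) (i : Fin d) :
    ∀ᵐ ω ∂P, ∀ t : ℝ≥0, (U *ᵥ (θ t ω - x₀)) i
      = -(μ i * ∫ s in (0 : ℝ)..t, (U *ᵥ (θ s.toNNReal ω - x₀)) i)
        + (U * G * CFC.sqrt S) i ⬝ᵥ B t ω := by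
  filter_upwards [hθ.continuous, hθ.equation] with ω hc he t
  have hc' : Continuous fun s : ℝ => θ s.toNNReal ω := hc.comp continuous_real_toNNReal
  let L : (Fin d → ℝ) →L[ℝ] ℝ :=
    (ContinuousLinearMap.proj i).comp (LinearMap.toContinuousLinearMap (toLin' U))
  have hL : ∀ x, L x = (U *ᵥ x) i := fun x => by simp [L]
  have hint : IntervalIntegrable (fun s : ℝ => (G * H) *ᵥ (θ s.toNNReal ω - a)) volume 0 t :=
    Continuous.intervalIntegrable (by fun_prop) _ _
  -- Stationarity of `x₀` recentres the drift, so the coordinate equations start at zero without a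
  -- constant term.
  have hz : ∀ x, H *ᵥ (x - a) = H *ᵥ (x - x₀) := fun x => by
    rw [← sub_add_sub_cancel x x₀ a, mulVec_add, h0, add_zero]
  have h1 : θ t ω - x₀ = -(∫ s in (0 : ℝ)..t, (G * H) *ᵥ (θ s.toNNReal ω - a))
      + (G * CFC.sqrt S) *ᵥ B t ω := by
    rw [he t]; abel
  rw [← hL, h1, map_add, map_neg, ← L.intervalIntegral_comp_comm hint, hL,
    mulVec_mulVec, ← mul_assoc, ← intervalIntegral.integral_const_mul]
  congr 2
  refine intervalIntegral.integral_congr fun s _ => ?_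
  rw [hL, ← mulVec_mulVec, hz, mulVec_mulVec, mulVec_mulVec, mul_assoc, hU, ← mulVec_mulVec,
    mulVec_diagonal]

/-- Identifies the variance rate of the noise in coordinate `i` with a diagonal entry of `N`. -/
theorem sqrt_row_dotProduct (hG : G.IsHermitian) (hS : S.PosSemidef) (i : Fin d) :
    (U * G * CFC.sqrt S) i ⬝ᵥ (U * G * CFC.sqrt S) i = (U * G * S * G * Uᵀ) i i := by
  have hss : CFC.sqrt S * CFC.sqrt S = S := CFC.sqrt_mul_sqrt_self S hS.nonneg
  have hs : (CFC.sqrt S)ᵀ = CFC.sqrt S := by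
    simpa using (Matrix.nonneg_iff_posSemidef.1 (CFC.sqrt_nonneg S)).isHermitian.eq
  have hGT : Gᵀ = G := by simpa using hG.eq
  have : U * G * S * G * Uᵀ = (U * G * CFC.sqrt S) * (U * G * CFC.sqrt S)ᵀ := by
    rw [transpose_mul, transpose_mul, hs, hGT]
    conv_lhs => rw [← hss]
    simp only [mul_assoc]
  rw [this]
  rfl

/-- Second moments of the diagonalizing coordinates. -/
theorem IsOUProcess.coordinate_second_moment [IsProbabilityMeasure P] (hB : IsBrownianVec B P)
    (hθ : IsOUProcess G H S a x₀ B θ P) (hG : G.IsHermitian) (hS : S.PosSemidef)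
    (hU : U * (G * H) = diagonal μ * U) (h0 : H *ᵥ (x₀ - a) = 0) (i : Fin d) (t : ℝ≥0) :
    MemLp (fun ω => (U *ᵥ (θ t ω - x₀)) i) 2 P ∧
      μ i * ∫ ω, (U *ᵥ (θ t ω - x₀)) i ^ 2 ∂P
        = (U * G * S * G * Uᵀ) i i * (1 - Real.exp (-(2 * μ i * t))) / 2 := by
  rw [← sqrt_row_dotProduct hG hS]
  refine scalar_second_moment (w := fun t ω => (U *ᵥ (θ t ω - x₀)) i)
    (b := fun t ω => (U * G * CFC.sqrt S) i ⬝ᵥ B t ω) ?_ ?_ ?_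
    (hθ.coordinate_equation hU h0 i) (hB.memLp_dotProduct _) (hB.integral_dotProduct_mul _) t
  · exact Finset.sum_nonneg fun _ _ => mul_self_nonneg _
  · filter_upwards [hθ.continuous] with ω h
    have : Continuous fun t => U *ᵥ (θ t ω - x₀) := by fun_prop
    exact (continuous_apply i).comp this
  · filter_upwards [hB.continuous] with ω h
    fun_prop

/-- The expected loss of the process started at a stationary point. -/
theorem IsOUProcess.integral_quadLoss [IsProbabilityMeasure P] (hB : IsBrownianVec B P)
    (hθ : IsOUProcess G H S a x₀ B θ P) (hG : G.IsHermitian) (hS : S.PosSemidef) (hH : H.IsSymm)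
    (hd : H = Uᵀ * diagonal μ * U) (hU : U * G * Uᵀ = 1) (h0 : H *ᵥ (x₀ - a) = 0)
    (c : ℝ) (t : ℝ≥0) :
    Integrable (fun ω => quadLoss c a H (θ t ω)) P ∧
      ∫ ω, quadLoss c a H (θ t ω) ∂P = quadLoss c a H x₀ +
        1 / 4 * ∑ i, (U * G * S * G * Uᵀ) i i * (1 - Real.exp (-(2 * μ i * t))) := by
  have hm := hθ.coordinate_second_moment hB hG hS (mul_mul_eq_of_congruence hd hU) h0
  have hi : ∀ i, Integrable (fun ω => μ i * (U *ᵥ (θ t ω - x₀)) i ^ 2) P := fun i =>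
    (hm i t).1.integrable_sq.const_mul _
  have hs : Integrable (fun ω => 1 / 2 * ∑ i, μ i * (U *ᵥ (θ t ω - x₀)) i ^ 2) P :=
    (integrable_finsetSum _ fun i _ => hi i).const_mul _
  have hq : ∀ ω, quadLoss c a H (θ t ω) = quadLoss c a H x₀ +
      1 / 2 * ∑ i, μ i * (U *ᵥ (θ t ω - x₀)) i ^ 2 := fun ω => quadLoss_eq_sum hH hd h0 _
  simp_rw [hq]
  refine ⟨(integrable_const _).add hs, ?_⟩
  rw [integral_add (integrable_const _) hs, integral_const_mul,
    integral_finsetSum _ fun i _ => hi i]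
  simp_rw [integral_const_mul, (hm _ t).2]
  simp only [integral_const, probReal_univ, one_smul, Finset.mul_sum]
  congr 1
  exact Finset.sum_congr rfl fun i _ => by ring

end Coordinates

/-! ### The logarithmic time and the escape bound -/

/-- A weighted sum of `1 - exp (-2 μ t)` with a negative rate is negative after a logarithmic
time. -/
theorem sum_mul_one_sub_exp_neg {d : ℕ} {n μ : Fin d → ℝ} {l T t : ℝ} {j : Fin d} (hl : 0 < l)
    (hn : ∀ i, l ≤ n i) (hj : μ j < 0) (hT : T = Real.log ((∑ i, n i) / l) / |2 * μ j|)
    (ht : T < t) : ∑ i, n i * (1 - Real.exp (-(2 * μ i * t))) < 0 := by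
  have hn0 : ∀ i, 0 ≤ n i := fun i => hl.le.trans (hn i)
  have hsum : 0 < ∑ i, n i :=
    (hl.trans_le (hn j)).trans_le (Finset.single_le_sum (fun i _ => hn0 i) (Finset.mem_univ j))
  have h2 : |2 * μ j| = -(2 * μ j) := abs_of_neg (by linarith)
  rw [hT, h2, div_lt_iff₀ (by linarith), Real.log_lt_iff_lt_exp (by positivity),
    div_lt_iff₀ hl] at ht
  -- All exponentials are nonnegative, so only the growing one, of index `j`, is kept.
  have h3 : l * Real.exp (-(2 * μ j * t)) ≤ ∑ i, n i * Real.exp (-(2 * μ i * t)) :=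
    (mul_le_mul_of_nonneg_right (hn j) (Real.exp_pos _).le).trans
      (Finset.single_le_sum (f := fun i => n i * Real.exp (-(2 * μ i * t)))
        (fun i _ => mul_nonneg (hn0 i) (Real.exp_pos _).le) (Finset.mem_univ j))
  have h4 : t * -(2 * μ j) = -(2 * μ j * t) := by ring
  rw [h4] at ht
  simp only [mul_sub, mul_one, Finset.sum_sub_distrib]
  linarith

end PrecondLangevin

theorem proposition6 {d : ℕ} {Ω : Type*} [MeasurableSpace Ω] (P : Measure Ω)
    [IsProbabilityMeasure P]
    (G H S : Matrix (Fin d) (Fin d) ℝ) (hG : G.PosDef) (hS : S.PosDef) (hH : H.IsSymm)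
    (c : ℝ) (a x₀ : Fin d → ℝ) (hx₀ : PrecondLangevin.IsSaddle c a H x₀)
    (B θ : ℝ≥0 → Ω → Fin d → ℝ) (hB : PrecondLangevin.IsBrownianVec B P)
    (hθ : PrecondLangevin.IsOUProcess G H S a x₀ B θ P) :
    (∀ t : ℝ≥0, Integrable (fun ω => PrecondLangevin.quadLoss c a H (θ t ω)) P) ∧
    PrecondLangevin.escapeTime (PrecondLangevin.quadLoss c a H) x₀ θ P ≤
      ((Real.log ((S * G).trace / PrecondLangevin.lambdaMin (S * G)) /
        |2 * PrecondLangevin.lambdaMin (G * H)| : ℝ) : EReal) := by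
  have hHh : H.IsHermitian := by simpa using hH
  obtain ⟨U, μ, hd, hU⟩ := PrecondLangevin.exists_simultaneous_diagonalization hG hHh
  have h0 := PrecondLangevin.mulVec_eq_zero_of_hasFDerivAt hH hx₀.1
  have key := hθ.integral_quadLoss hB hG.isHermitian hS.posSemidef hH hd hU h0 c
  refine ⟨fun t => (key t).1, ?_⟩
  obtain ⟨j, hj, hj0⟩ := PrecondLangevin.exists_eq_lambdaMin_neg hd hU hG hx₀.2
  have : NeZero d := ⟨fun h => (h ▸ j).elim0⟩
  have hl := PrecondLangevin.lambdaMin_pos hG hS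
  have hn := PrecondLangevin.lambdaMin_le_diag hG hS hU
  have htr : (S * G).trace = ∑ i, (U * G * S * G * Uᵀ) i i := by
    rw [← PrecondLangevin.trace_congruence hU]; rfl
  have hT : 0 ≤ Real.log ((S * G).trace / PrecondLangevin.lambdaMin (S * G)) /
      |2 * PrecondLangevin.lambdaMin (G * H)| := by
    refine div_nonneg (Real.log_nonneg ?_) (abs_nonneg _)
    rw [one_le_div hl, htr]
    exact (hn j).trans (Finset.single_le_sum (f := fun i => (U * G * S * G * Uᵀ) i i)
      (fun i _ => hl.le.trans (hn i)) (Finset.mem_univ j))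
  -- The loss is strictly smaller at each time beyond the bound, but perhaps not at the bound
  -- itself: for `d = 1` the bound is `0`.
  refine EReal.le_of_forall_lt_iff_le.1 fun z hz => ?_
  rw [EReal.coe_lt_coe_iff] at hz
  lift z to ℝ≥0 using hT.trans hz.le
  refine sInf_le ⟨z, ?_, rfl⟩
  change ∫ ω, PrecondLangevin.quadLoss c a H (θ z ω) ∂P < PrecondLangevin.quadLoss c a H x₀
  have := PrecondLangevin.sum_mul_one_sub_exp_neg
    (n := fun i => (U * G * S * G * Uᵀ) i i) (μ := μ) hl hn hj0 (by rw [hj, htr]) hz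
  rw [(key _).2]
  linarith
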